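/- Let $m\ge 2$ and $k\ge 2$ be integers. Let $\sigma_m$ be the morphism on finite words over the alphabet $\{0,\dots,m-1\}$ given by $\sigma_m(i)=i\,(i+1)\cdots(i+m-1)$, letters being reduced modulo $m$, and let $\mathbf t_m=\lim_{j\to\infty}\sigma_m^j(0)$ be the generalized Thue--Morse word. For finite words $u,x$ let $\binom{u}{x}$ be the number of occurrences of $x$ as a subword (i.e. a not necessarily contiguous subsequence) of $u$, and call two words $u,v$ $k$-binomially equivalent if $\binom{u}{x}=\binom{v}{x}$ for every word $x$ of length at most $k$. Let $b^{(k)}_{\mathbf t_m}(n)$ denote the number of $k$-binomial equivalence classes of factors (i.e. contiguous subwords) of length $n$ of $\mathbf t_m$. Then the sequence $\bigl(b^{(k)}_{\mathbf t_m}(n)\bigr)_{n\ge m^k}$ is periodic with period $m^k$, that is, $b^{(k)}_{\mathbf t_m}(n+m^k)=b^{(k)}_{\mathbf t_m}(n)$ for every $n\ge m^k$. (For $k\ge 3$ this confirms the conjecture of Lü, Chen, Wen and Wu.) -/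

import Mathlib

namespace GenThueMorse

/-- The image of a letter under the symmetric morphism `σ_m`:
`i ↦ i (i+1) ⋯ (i+m-1)`, letters being taken modulo `m`. -/
def sigmaLetter (m : ℕ) (i : ZMod m) : List (ZMod m) :=
  (List.range m).map fun r => i + (r : ZMod m)

/-- The morphism `σ_m` on finite words over the alphabet `{0, …, m-1}`. -/
def sigma (m : ℕ) (u : List (ZMod m)) : List (ZMod m) :=
  u.flatMap (sigmaLetter m)

/-- The generalized Thue–Morse word `t_m = lim_j σ_m^j(0)` (for `m ≥ 2`). Its letter at
position `n` is read in `σ_m^n(0)`, which has length `m ^ n > n`; see `sigma_iterate_eq` below: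
every `σ_m^j(0)` is a prefix of `t_m`. -/
def thueMorse (m : ℕ) (n : ℕ) : ZMod m :=
  ((sigma m)^[n] [0]).getD n 0

/-- The factor of length `n` of the infinite word `w` starting at position `i`. -/
def factorAt {A : Type*} (w : ℕ → A) (i n : ℕ) : List A :=
  (List.range n).map fun j => w (i + j)

/-- The set of factors of length `n` of the infinite word `w`. -/
def factors {A : Type*} (w : ℕ → A) (n : ℕ) : Set (List A) :=
  {u | ∃ i, u = factorAt w i n}

/-- The binomial coefficient of words: the number of occurrences of `x` as a (scattered)
subword of `u`. The list `u.sublists` has one entry for each set of positions of `u`. -/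
def binom {A : Type*} [DecidableEq A] (u x : List A) : ℕ :=
  u.sublists.count x

/-- `k`-binomial equivalence of finite words. -/
def BinomEquiv {A : Type*} [DecidableEq A] (k : ℕ) (u v : List A) : Prop :=
  ∀ x : List A, x.length ≤ k → binom u x = binom v x

/-- `k`-binomial equivalence, as an equivalence relation on the factors of length `n`. -/
def factorSetoid {A : Type*} [DecidableEq A] (k : ℕ) (w : ℕ → A) (n : ℕ) :
    Setoid (factors w n) where
  r u v := BinomEquiv k (u : List A) (v : List A)
  iseqv :=
    ⟨fun _ _ _ => rfl, fun h x hx => (h x hx).symm, fun h h' x hx => (h x hx).trans (h' x hx)⟩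

/-- The `k`-binomial complexity function of the infinite word `w` (over a finite alphabet):
the number of `k`-binomial equivalence classes of factors of length `n`. -/
noncomputable def binomComplexity {A : Type*} [DecidableEq A] (k : ℕ) (w : ℕ → A) (n : ℕ) : ℕ :=
  Nat.card (Quotient (factorSetoid k w n))

theorem length_sigma (m : ℕ) (u : List (ZMod m)) : (sigma m u).length = m * u.length := by
  induction u with
  | nil => simp [sigma]
  | cons a u ih =>
    simp only [sigma, List.flatMap_cons, List.length_append] at ih ⊢
    rw [ih]
    simp [sigmaLetter]
    ring

theorem length_sigma_iterate (m j : ℕ) : ((sigma m)^[j] [0]).length = m ^ j := by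
  induction j with
  | zero => simp
  | succ j ih => rw [Function.iterate_succ_apply', length_sigma, ih, pow_succ, mul_comm]

theorem sigma_iterate_prefix_succ {m : ℕ} (hm : 2 ≤ m) (j : ℕ) :
    (sigma m)^[j] [0] <+: (sigma m)^[j + 1] [0] := by
  induction j with
  | zero =>
    obtain ⟨m, rfl⟩ : ∃ m', m = m' + 1 := ⟨m - 1, by omega⟩
    simp [sigma, sigmaLetter, List.range_succ_eq_map]
  | succ j ih =>
    rw [Function.iterate_succ_apply', Function.iterate_succ_apply' (n := j + 1)]
    obtain ⟨s, hs⟩ := ih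
    exact ⟨sigma m s, by rw [← hs]; simp [sigma]⟩

theorem sigma_iterate_prefix {m : ℕ} (hm : 2 ≤ m) {i j : ℕ} (h : i ≤ j) :
    (sigma m)^[i] [0] <+: (sigma m)^[j] [0] := by
  induction j, h using Nat.le_induction with
  | base => exact List.prefix_rfl
  | succ j _ ih => exact ih.trans (sigma_iterate_prefix_succ hm j)

/-- Every `σ_m^j(0)` is the prefix of length `m ^ j` of `t_m`, so that `t_m` is their limit. -/
theorem sigma_iterate_eq {m : ℕ} (hm : 2 ≤ m) (j : ℕ) :
    (sigma m)^[j] [0] = factorAt (thueMorse m) 0 (m ^ j) := by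
  apply List.ext_getElem
  · simp [factorAt, length_sigma_iterate]
  · intro n h1 h2
    have h3 : n < ((sigma m)^[n] [0]).length := by
      rw [length_sigma_iterate]; exact Nat.lt_pow_self (by omega)
    simp only [factorAt, List.getElem_map, List.getElem_range, Nat.zero_add, thueMorse]
    rw [List.getD_eq_getElem _ _ h3]
    rcases le_total n j with h | h
    · exact ((sigma_iterate_prefix hm h).getElem h3).symm
    · exact (sigma_iterate_prefix hm h).getElem h1

end GenThueMorse

/-!
Cut `t_m` into blocks of length `m ^ (k - 1)`, that is, into images of letters under `σ_m^(k-1)`.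
Two factors of the same length `n ≥ m ^ k` are `k`-binomially equivalent if and only if they are cut
in the same way: at the same offset, with the same letters at the blocks met only in part, and with
the same full blocks up to order.

One direction holds because `σ_m^j` makes permutations of each other `(j + 1)`-equivalent. For the
other, induct on `k`: once the letters of `x` are known up to order, the coefficients of `σ_m^j(x)`
at words of length `j + 2` determine, for every function `h` on the letters, the sum of `h` over the
letters of `x`, each weighted by the number of letters following it. Inside a block of length `m`
the word `t_m` increases by `1` at each step, so for functions of the form `h (a + 1) - h a` these
sums telescope, and what is left are the end letters and the residues modulo `m` at which the blocks
are cut.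

Periodicity follows because lengthening a factor by `m ^ k` without changing its ends adds each
letter exactly once to the full blocks, and every pair of end letters occurs in `t_m` at every
positive distance.
-/

namespace GenThueMorse

section Binom

variable {A : Type*} [DecidableEq A]

theorem binom_eq_count_sublists' (u x : List A) : binom u x = u.sublists'.count x :=
  (List.sublists_perm_sublists' u).count_eq x

theorem binom_nil_right (u : List A) : binom u [] = 1 := by
  rw [binom_eq_count_sublists']
  induction u with
  | nil => simp
  | cons a u ih =>
    rw [List.sublists'_cons, List.count_append, ih, Nat.add_eq_left, List.count_eq_zero]
    simp

theorem binom_nil_cons (b : A) (w : List A) : binom [] (b :: w) = 0 := by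
  simp [binom]

theorem binom_cons_cons (a : A) (u : List A) (b : A) (w : List A) :
    binom (a :: u) (b :: w) = binom u (b :: w) + if a = b then binom u w else 0 := by
  simp only [binom_eq_count_sublists', List.sublists'_cons, List.count_append]
  congr 1
  split_ifs with hab
  · subst hab
    exact List.count_map_of_injective _ _ List.cons_injective _
  · rw [List.count_eq_zero]
    simp [hab]

theorem binom_singleton (u : List A) (a : A) : binom u [a] = u.count a := by
  induction u with
  | nil => simp [binom_nil_cons]
  | cons b u ih =>
    rw [binom_cons_cons, ih, binom_nil_right, List.count_cons]
    simp

theorem binom_append (u v w : List A) :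
    binom (u ++ v) w =
      ∑ i ∈ Finset.range (w.length + 1), binom u (w.take i) * binom v (w.drop i) := by
  induction u generalizing w with
  | nil =>
    rw [Finset.sum_range_succ', Finset.sum_eq_zero]
    · simp [binom_nil_right]
    · intro i hi
      cases w with
      | nil => simp at hi
      | cons b w => simp [binom_nil_cons]
  | cons a u ih =>
    cases w with
    | nil => simp [binom_nil_right]
    | cons b w =>
      rw [List.cons_append, binom_cons_cons, ih, List.length_cons, Finset.sum_range_succ',
        Finset.sum_range_succ' (n := w.length + 1)]
      simp only [List.take_succ_cons, List.drop_succ_cons, List.take_zero, List.drop_zero,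
        binom_nil_right, binom_cons_cons, add_mul, Finset.sum_add_distrib]
      split_ifs with hab
      · rw [ih]; ring
      · simp

namespace BinomEquiv

theorem refl (k : ℕ) (u : List A) : BinomEquiv k u u := fun _ _ => rfl

theorem symm {k : ℕ} {u v : List A} (h : BinomEquiv k u v) : BinomEquiv k v u :=
  fun x hx => (h x hx).symm

theorem trans {k : ℕ} {u v w : List A} (h : BinomEquiv k u v) (h' : BinomEquiv k v w) :
    BinomEquiv k u w :=
  fun x hx => (h x hx).trans (h' x hx)

theorem mono {k l : ℕ} (hkl : k ≤ l) {u v : List A} (h : BinomEquiv l u v) :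
    BinomEquiv k u v :=
  fun x hx => h x (hx.trans hkl)

theorem append {k : ℕ} {u v u' v' : List A} (hu : BinomEquiv k u u') (hv : BinomEquiv k v v') :
    BinomEquiv k (u ++ v) (u' ++ v') := by
  intro x hx
  rw [binom_append, binom_append]
  refine Finset.sum_congr rfl fun i _ => ?_
  rw [hu _ (by simp; omega), hv _ (by simp; omega)]

theorem cancel_left {k : ℕ} {p u v : List A} (h : BinomEquiv k (p ++ u) (p ++ v)) :
    BinomEquiv k u v := by
  intro x hx
  induction hl : x.length using Nat.strong_induction_on generalizing x with
  | _ n ih =>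
    have hsum := h x hx
    rw [binom_append, binom_append, Finset.sum_range_succ', Finset.sum_range_succ'] at hsum
    simp only [List.take_zero, binom_nil_right, List.drop_zero, one_mul] at hsum
    refine Nat.add_left_cancel (hsum.trans (congrArg (· + _) ?_))
    refine Finset.sum_congr rfl fun i hi => ?_
    rw [Finset.mem_range] at hi
    rw [ih (x.length - (i + 1)) (by omega) (x.drop (i + 1)) (by simp; omega) (by simp)]

theorem cancel_right {k : ℕ} {p u v : List A} (h : BinomEquiv k (u ++ p) (v ++ p)) :
    BinomEquiv k u v := by
  intro x hx
  induction hl : x.length using Nat.strong_induction_on generalizing x with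
  | _ n ih =>
    have hsum := h x hx
    rw [binom_append, binom_append, Finset.sum_range_succ, Finset.sum_range_succ] at hsum
    simp only [List.take_length, binom_nil_right, List.drop_length, mul_one] at hsum
    refine Nat.add_left_cancel (hsum.trans (congrArg (· + _) ?_))
    refine Finset.sum_congr rfl fun i hi => ?_
    rw [Finset.mem_range] at hi
    rw [ih i (by omega) (x.take i) (by simp; omega) (by simp; omega)]

end BinomEquiv

theorem binomEquiv_zero (u v : List A) : BinomEquiv 0 u v := by
  intro x hx
  rw [List.eq_nil_of_length_eq_zero (Nat.le_zero.1 hx), binom_nil_right, binom_nil_right]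

theorem binomEquiv_one_iff_perm {u v : List A} : BinomEquiv 1 u v ↔ u.Perm v := by
  rw [List.perm_iff_count]
  constructor
  · intro h a
    rw [← binom_singleton, ← binom_singleton, h _ (by simp)]
  · intro h x hx
    match x, hx with
    | [], _ => simp only [binom_nil_right]
    | [a], _ => simp only [binom_singleton, h]

theorem binom_append_sub_of_binomEquiv {k : ℕ} {u u' v v' w : List A}
    (hu : BinomEquiv k u u') (hv : BinomEquiv k v v') (hw : w.length = k + 1) :
    (binom (u ++ v) w : ℤ) - binom (u' ++ v') w =
      ((binom u w : ℤ) - binom u' w) + ((binom v w : ℤ) - binom v' w) := by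
  have hmiddle : ∀ i ∈ Finset.range k,
      binom u (w.take (i + 1)) * binom v (w.drop (i + 1)) =
        binom u' (w.take (i + 1)) * binom v' (w.drop (i + 1)) := by
    intro i hi
    rw [Finset.mem_range] at hi
    rw [hu _ (by simp; omega), hv _ (by simp; omega)]
  rw [binom_append, binom_append, hw, Finset.sum_range_succ, Finset.sum_range_succ',
    Finset.sum_range_succ, Finset.sum_range_succ', Finset.sum_congr rfl hmiddle, ← hw]
  simp only [List.take_zero, List.drop_zero, List.take_length, List.drop_length, binom_nil_right]
  push_cast
  ring

theorem BinomEquiv.append_comm {k : ℕ} {u v : List A} (h : BinomEquiv k u v) :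
    BinomEquiv (k + 1) (u ++ v) (v ++ u) := by
  intro x hx
  rcases hx.lt_or_eq with hlt | heq
  · exact h.append h.symm x (by omega)
  · have := binom_append_sub_of_binomEquiv h h.symm heq
    omega

theorem binom_append_comm_sub_of_binomEquiv {k : ℕ} {u u' v : List A}
    (h : BinomEquiv (k + 1) u u') (hv : v.length = k + 1) (b b' : A) :
    (binom (u ++ u') (b :: (v ++ [b'])) : ℤ) - binom (u' ++ u) (b :: (v ++ [b'])) =
      u.count b * ((binom u' (v ++ [b']) : ℤ) - binom u (v ++ [b'])) +
        ((binom u (b :: v) : ℤ) - binom u' (b :: v)) * u.count b' := by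
  set w := b :: (v ++ [b']) with hw
  have hlength : w.length = k + 3 := by simp [hw, hv]
  have htake : w.take (k + 2) = b :: v := by
    rw [hw, List.take_succ_cons, ← hv, List.take_left]
  have hdrop : w.drop (k + 2) = [b'] := by
    rw [hw, List.drop_succ_cons, ← hv, List.drop_left]
  have hmiddle : ∀ i ∈ Finset.range k,
      binom u (w.take (i + 1 + 1)) * binom u' (w.drop (i + 1 + 1)) =
        binom u' (w.take (i + 1 + 1)) * binom u (w.drop (i + 1 + 1)) := by
    intro i hi
    rw [Finset.mem_range] at hi
    rw [h _ (by simp; omega), h _ (by simp; omega)]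
  have hsplit : ∀ x y : List A, binom (x ++ y) w =
      (∑ i ∈ Finset.range k, binom x (w.take (i + 1 + 1)) * binom y (w.drop (i + 1 + 1))) +
        binom x [b] * binom y (v ++ [b']) + binom y w + binom x (b :: v) * binom y [b'] +
        binom x w := by
    intro x y
    rw [binom_append, hlength, Finset.sum_range_succ, Finset.sum_range_succ,
      Finset.sum_range_succ', Finset.sum_range_succ', htake, hdrop, ← hlength,
      List.take_length, List.drop_length]
    simp [hw, binom_nil_right]
  rw [hsplit, hsplit, Finset.sum_congr rfl hmiddle, ← h [b] (by simp), ← h [b'] (by simp),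
    binom_singleton, binom_singleton]
  push_cast
  ring

end Binom

section SuffixWeight

variable {A : Type*}

/-- The sum of `h` over the letters of a word, each letter being weighted by the number of
letters that follow it. It collects the contributions of a linear combination of the binomial
coefficients of words of length two. -/
def suffixWeight (h : A → ℤ) : List A → ℤ
  | [] => 0
  | a :: x => x.length * h a + suffixWeight h x

theorem suffixWeight_append_singleton (h : A → ℤ) (x : List A) (a : A) :
    suffixWeight h (x ++ [a]) = suffixWeight h x + (x.map h).sum := by
  induction x with
  | nil => simp [suffixWeight]
  | cons b x ih =>
    simp only [List.cons_append, suffixWeight, ih, List.length_append, List.length_singleton,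
      List.map_cons, List.sum_cons]
    push_cast
    ring

theorem suffixWeight_map_range (h : A → ℤ) (f : ℕ → A) (n : ℕ) :
    suffixWeight h ((List.range n).map f) =
      ∑ k ∈ Finset.range n, ∑ s ∈ Finset.range k, h (f s) := by
  induction n with
  | zero => simp [suffixWeight]
  | succ n ih =>
    rw [List.range_succ, List.map_append, List.map_singleton, suffixWeight_append_singleton, ih,
      Finset.sum_range_succ, List.map_map]
    rfl

theorem suffixWeight_one (x : List A) :
    suffixWeight 1 x = ∑ k ∈ Finset.range x.length, (k : ℤ) := by
  induction x with
  | nil => simp [suffixWeight]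
  | cons a x ih => rw [suffixWeight, ih, List.length_cons, Finset.sum_range_succ]; simp [add_comm]

variable [DecidableEq A] [Fintype A]

theorem suffixWeight_eq_sum_single (h : A → ℤ) (x : List A) :
    suffixWeight h x = ∑ b, suffixWeight (Pi.single b 1) x * h b := by
  induction x with
  | nil => simp [suffixWeight]
  | cons a x ih =>
    simp only [suffixWeight, add_mul, Finset.sum_add_distrib, ← ih, Pi.single_apply]
    simp

theorem sum_binom_pair (x : List A) (b : A) :
    ∑ c, (binom x [b, c] : ℤ) = suffixWeight (Pi.single b 1) x := by
  induction x with
  | nil => simp [suffixWeight, binom_nil_cons]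
  | cons a x ih =>
    have hcount : ∑ c, (x.count c : ℤ) = x.length := by
      rw [← Nat.cast_sum, Nat.cast_inj]
      simpa using Multiset.sum_count_eq_card (s := Finset.univ) (m := (x : Multiset A)) (by simp)
    simp only [binom_cons_cons, Nat.cast_add, Finset.sum_add_distrib, ih, suffixWeight,
      Pi.single_apply]
    split_ifs
    · simp only [binom_singleton, hcount]; ring
    · simp

end SuffixWeight

section Morphism

variable {m : ℕ}

theorem sigma_append (u v : List (ZMod m)) : sigma m (u ++ v) = sigma m u ++ sigma m v := by
  simp [sigma]

theorem sigma_iterate_append (j : ℕ) (u v : List (ZMod m)) :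
    (sigma m)^[j] (u ++ v) = (sigma m)^[j] u ++ (sigma m)^[j] v := by
  induction j generalizing u v with
  | zero => rfl
  | succ j ih => rw [Function.iterate_succ_apply, sigma_append, ih]; rfl

theorem sigma_iterate_cons (j : ℕ) (a : ZMod m) (u : List (ZMod m)) :
    (sigma m)^[j] (a :: u) = (sigma m)^[j] [a] ++ (sigma m)^[j] u :=
  sigma_iterate_append j [a] u

theorem sigma_singleton (a : ZMod m) : sigma m [a] = sigmaLetter m a := by simp [sigma]

theorem sigmaLetter_eq_map_range (a : ZMod m) :
    sigmaLetter m a = (List.range m).map fun r : ℕ => a + (r : ZMod m) := by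
  simp [sigmaLetter, ← List.map_eq_flatMap]

theorem length_iterate_sigma (j : ℕ) (u : List (ZMod m)) :
    ((sigma m)^[j] u).length = m ^ j * u.length := by
  induction j with
  | zero => simp
  | succ j ih => rw [Function.iterate_succ_apply', length_sigma, ih]; ring

variable [NeZero m]

theorem count_sigmaLetter (a b : ZMod m) : (sigmaLetter m a).count b = 1 := by
  rw [sigmaLetter_eq_map_range]
  refine List.count_eq_one_of_mem ?_ ?_
  · refine List.Nodup.map_on (fun r hr s hs hrs => ?_) List.nodup_range
    rw [List.mem_range] at hr hs
    rw [← ZMod.val_cast_of_lt hr, ← ZMod.val_cast_of_lt hs, add_left_cancel hrs]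
  · exact List.mem_map.2 ⟨(b - a).val, List.mem_range.2 (ZMod.val_lt _), by simp⟩

theorem count_sigma (u : List (ZMod m)) (b : ZMod m) : (sigma m u).count b = u.length := by
  induction u with
  | nil => simp [sigma]
  | cons a u ih =>
    rw [sigma, List.flatMap_cons, List.count_append, ← sigma, ih, count_sigmaLetter,
      List.length_cons, add_comm]

theorem count_sigma_iterate_succ (j : ℕ) (u : List (ZMod m)) (b : ZMod m) :
    ((sigma m)^[j + 1] u).count b = m ^ j * u.length := by
  rw [Function.iterate_succ_apply', count_sigma, length_iterate_sigma]

theorem perm_sigma_of_length_eq {x y : List (ZMod m)} (h : x.length = y.length) :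
    (sigma m x).Perm (sigma m y) :=
  List.perm_iff_count.2 fun b => by rw [count_sigma, count_sigma, h]

namespace BinomEquiv

theorem sigma_iterate_of_perm (j : ℕ) {x y : List (ZMod m)} (h : x.Perm y) :
    BinomEquiv (j + 1) ((sigma m)^[j] x) ((sigma m)^[j] y) := by
  induction j generalizing x y with
  | zero => exact binomEquiv_one_iff_perm.2 h
  | succ j ih =>
    induction h with
    | nil => exact refl _ _
    | @cons a x y _ ih' =>
      rw [sigma_iterate_cons _ a x, sigma_iterate_cons _ a y]
      exact (refl _ _).append ih'
    | swap a b l =>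
      have hab : BinomEquiv (j + 1) ((sigma m)^[j + 1] [b]) ((sigma m)^[j + 1] [a]) := by
        rw [Function.iterate_succ_apply, Function.iterate_succ_apply]
        exact ih (perm_sigma_of_length_eq (by simp))
      rw [sigma_iterate_cons, sigma_iterate_cons _ a, sigma_iterate_cons _ a (b :: l),
        sigma_iterate_cons _ b l, ← List.append_assoc, ← List.append_assoc]
      exact hab.append_comm.append (refl _ _)
    | trans _ _ h₁ h₂ => exact h₁.trans h₂

theorem sigma_iterate_of_length_eq (j : ℕ) {x y : List (ZMod m)} (h : x.length = y.length) :
    BinomEquiv j ((sigma m)^[j] x) ((sigma m)^[j] y) := by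
  cases j with
  | zero => exact binomEquiv_zero _ _
  | succ j =>
    rw [Function.iterate_succ_apply, Function.iterate_succ_apply]
    exact sigma_iterate_of_perm j (perm_sigma_of_length_eq h)

end BinomEquiv

end Morphism

section BinomForm

variable {m : ℕ}

/-- The number of occurrences of `w` in `σ_m^j(a)`, as an integer-valued function of the letter
`a`. -/
def letterBinom (m j : ℕ) (w : List (ZMod m)) (a : ZMod m) : ℤ :=
  binom ((sigma m)^[j] [a]) w

theorem binom_sigma_iterate_sub_of_perm [NeZero m] (j : ℕ) {x y v : List (ZMod m)}
    (hxy : x.Perm y) (hv : v.length = j + 1) (b b' : ZMod m) :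
    (binom ((sigma m)^[j + 1] x) (b :: (v ++ [b'])) : ℤ) -
        binom ((sigma m)^[j + 1] y) (b :: (v ++ [b'])) =
      m ^ j *
        (suffixWeight (letterBinom m (j + 1) (b :: v) - letterBinom m (j + 1) (v ++ [b'])) x -
          suffixWeight (letterBinom m (j + 1) (b :: v) - letterBinom m (j + 1) (v ++ [b'])) y) := by
  have hlength : (b :: (v ++ [b'])).length = j + 2 + 1 := by simp [hv]
  induction hxy with
  | nil => simp
  | @cons a x y hxy ih =>
    rw [sigma_iterate_cons, sigma_iterate_cons (j + 1) a y, binom_append_sub_of_binomEquiv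
      (.refl _ _) (BinomEquiv.sigma_iterate_of_perm (j + 1) hxy) hlength, ih,
      suffixWeight, suffixWeight, hxy.length_eq]
    ring
  | swap a a' l =>
    have haa' : BinomEquiv (j + 1) ((sigma m)^[j + 1] [a']) ((sigma m)^[j + 1] [a]) :=
      .sigma_iterate_of_length_eq (j + 1) (by simp)
    rw [sigma_iterate_cons, sigma_iterate_cons _ a, sigma_iterate_cons _ a (a' :: l),
      sigma_iterate_cons _ a' l, ← List.append_assoc, ← List.append_assoc,
      binom_append_sub_of_binomEquiv haa'.append_comm (.refl _ _) hlength,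
      binom_append_comm_sub_of_binomEquiv haa' hv, count_sigma_iterate_succ,
      count_sigma_iterate_succ]
    simp only [suffixWeight, letterBinom, Pi.sub_apply, List.length_cons, List.length_nil]
    push_cast
    ring
  | trans _ _ ih₁ ih₂ => linear_combination ih₁ + ih₂

theorem eq_of_shift_invariant {A M : Type*} {n : ℕ} {f : List A → M}
    (h : ∀ b b' v, v.length = n → f (b :: v) = f (v ++ [b'])) {u w : List A}
    (hu : u.length = n + 1) (hw : w.length = n + 1) : f w = f u := by
  have hrotate : ∀ i ≤ n + 1, f w = f (w.drop i ++ u.take i) := by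
    intro i hi
    induction i with
    | zero => simp
    | succ i ih =>
      rw [ih (by omega), List.drop_eq_getElem_cons (by omega : i < w.length), List.cons_append,
        h _ (u[i]'(by omega)) _ (by simp; omega), List.append_assoc, List.take_append_getElem]
  rw [hrotate (n + 1) le_rfl, ← hw, List.drop_length, hw, ← hu, List.take_length, List.nil_append]

variable [NeZero m]

/-- The linear combination, with coefficients `d`, of the functions `binom (σ_m^j(a))`. -/
def binomForm (j : ℕ) (d : ZMod m → ℤ) (w : List (ZMod m)) : ℤ :=
  ∑ a, d a * letterBinom m j w a

/-- The coefficients obtained from `d` by reading off the `suffixWeight` of the letter `b` in the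
words `σ_m(a)`. They express `binomForm (j + 2) d` through `binomForm (j + 1)`. -/
def liftCoeff (d : ZMod m → ℤ) (b : ZMod m) : ℤ :=
  ∑ a, d a * suffixWeight (Pi.single b 1) (sigmaLetter m a)

theorem sum_liftCoeff_mul (d e : ZMod m → ℤ) :
    ∑ b, liftCoeff d b * e b = ∑ a, d a * suffixWeight e (sigmaLetter m a) := by
  simp only [liftCoeff, Finset.sum_mul]
  rw [Finset.sum_comm]
  simp only [suffixWeight_eq_sum_single e, Finset.mul_sum, mul_assoc]

theorem sum_liftCoeff {d : ZMod m → ℤ} (hd : ∑ a, d a = 0) : ∑ b, liftCoeff d b = 0 := by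
  have h := sum_liftCoeff_mul d 1
  simpa [suffixWeight_one, sigmaLetter, ← Finset.sum_mul, hd] using h

theorem sum_range_natCast {M : Type*} [AddCommMonoid M] (f : ZMod m → M) :
    ∑ r ∈ Finset.range m, f (r : ZMod m) = ∑ a, f a := by
  refine Finset.sum_bij' (fun r _ => (r : ZMod m)) (fun a _ => a.val) (by simp) ?_ ?_ (by simp)
    (by simp)
  · exact fun a _ => Finset.mem_range.2 (ZMod.val_lt a)
  · exact fun r hr => ZMod.val_cast_of_lt (Finset.mem_range.1 hr)

theorem suffixWeight_fwdDiff_sigmaLetter (h : ZMod m → ℤ) (a : ZMod m) :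
    suffixWeight (fun x => h (x + 1) - h x) (sigmaLetter m a) = ∑ x, h x - m * h a := by
  have htelescope (k : ℕ) :
      ∑ s ∈ Finset.range k, (h (a + s + 1) - h (a + s)) = h (a + k) - h a := by
    simpa [add_assoc] using Finset.sum_range_sub (fun s : ℕ => h (a + s)) k
  rw [sigmaLetter_eq_map_range, suffixWeight_map_range]
  simp only [htelescope, Finset.sum_sub_distrib, Finset.sum_const, Finset.card_range,
    nsmul_eq_mul]
  rw [sum_range_natCast fun x => h (a + x),
    Fintype.sum_equiv (Equiv.addLeft a) (fun x => h (a + x)) h fun _ => rfl]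

theorem eq_zero_of_liftCoeff_eq_zero {d : ZMod m → ℤ} (hd : ∑ a, d a = 0)
    (hlift : liftCoeff d = 0) : d = 0 := by
  funext c
  have h := sum_liftCoeff_mul d fun x =>
    (Pi.single c 1 : ZMod m → ℤ) (x + 1) - (Pi.single c 1 : ZMod m → ℤ) x
  simp only [hlift, suffixWeight_fwdDiff_sigmaLetter, mul_sub, Finset.sum_sub_distrib,
    ← Finset.sum_mul, hd, Pi.zero_apply, zero_mul, zero_sub] at h
  simpa [Pi.single_apply, NeZero.ne] using h

theorem sum_binomForm_one_pair (d : ZMod m → ℤ) (b : ZMod m) :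
    ∑ b', binomForm 1 d [b, b'] = liftCoeff d b := by
  simp only [binomForm, letterBinom, liftCoeff, Function.iterate_one, sigma_singleton,
    ← sum_binom_pair, Finset.mul_sum]
  exact Finset.sum_comm

theorem binomForm_add_two {d : ZMod m → ℤ} (hd : ∑ a, d a = 0) {j : ℕ} {v : List (ZMod m)}
    (hv : v.length = j + 1) (b b' : ZMod m) :
    binomForm (j + 2) d (b :: (v ++ [b'])) =
      m ^ j *
        (binomForm (j + 1) (liftCoeff d) (b :: v) -
          binomForm (j + 1) (liftCoeff d) (v ++ [b'])) := by
  set g := letterBinom m (j + 1) (b :: v) - letterBinom m (j + 1) (v ++ [b'])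
  set w := b :: (v ++ [b'])
  have hletter (a : ZMod m) : letterBinom m (j + 2) w a = letterBinom m (j + 2) w 0 +
      m ^ j * (suffixWeight g (sigmaLetter m a) - suffixWeight g (sigmaLetter m 0)) := by
    rw [← sub_eq_iff_eq_add', ← sigma_singleton, ← sigma_singleton]
    exact binom_sigma_iterate_sub_of_perm j (perm_sigma_of_length_eq (by simp)) hv b b'
  calc binomForm (j + 2) d w
      = (∑ a, d a) * (letterBinom m (j + 2) w 0 - m ^ j * suffixWeight g (sigmaLetter m 0)) +
          m ^ j * ∑ a, d a * suffixWeight g (sigmaLetter m a) := by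
        rw [Finset.sum_mul, Finset.mul_sum, ← Finset.sum_add_distrib]
        exact Finset.sum_congr rfl fun a _ => by rw [hletter]; ring
    _ = m ^ j * ∑ a, liftCoeff d a * g a := by rw [hd, zero_mul, zero_add, sum_liftCoeff_mul]
    _ = _ := by simp only [g, Pi.sub_apply, mul_sub, Finset.sum_sub_distrib, binomForm]

theorem eq_zero_of_binomForm_shift_invariant {j : ℕ} {d : ZMod m → ℤ} (hd : ∑ a, d a = 0)
    (hshift : ∀ b b' v, v.length = j + 1 →
      binomForm (j + 1) d (b :: v) = binomForm (j + 1) d (v ++ [b'])) : d = 0 := by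
  induction j generalizing d with
  | zero =>
    refine eq_zero_of_liftCoeff_eq_zero hd ?_
    have hconst (b : ZMod m) : liftCoeff d b = m * binomForm 1 d [0, 0] := by
      rw [← sum_binomForm_one_pair, Finset.sum_congr rfl fun b' _ =>
        eq_of_shift_invariant hshift (w := [b, b']) (u := [0, 0]) rfl rfl]
      simp
    have hzero : binomForm 1 d [0, 0] = 0 := by
      simpa [hconst, NeZero.ne] using sum_liftCoeff hd
    funext b
    rw [hconst, hzero, mul_zero, Pi.zero_apply]
  | succ j ih =>
    have hzero : ∀ w : List (ZMod m), w.length = j + 3 → binomForm (j + 2) d w = 0 := by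
      intro w hw
      rw [eq_of_shift_invariant hshift (u := 0 :: (List.replicate (j + 1) 0 ++ [0])) (by simp) hw,
        binomForm_add_two hd (by simp), ← List.replicate_succ', ← List.replicate_succ, sub_self,
        mul_zero]
    refine eq_zero_of_liftCoeff_eq_zero hd (ih (sum_liftCoeff hd) fun b b' v hv => ?_)
    have h := hzero (b :: (v ++ [b'])) (by simp [hv])
    rw [binomForm_add_two hd hv] at h
    simpa [NeZero.ne, sub_eq_zero] using h

theorem suffixWeight_eq_of_binomEquiv {j : ℕ} {x y : List (ZMod m)} (hxy : x.Perm y)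
    (h : BinomEquiv (j + 2) ((sigma m)^[j] x) ((sigma m)^[j] y)) (g : ZMod m → ℤ) :
    suffixWeight g x = suffixWeight g y := by
  set d : ZMod m → ℤ := fun b =>
    suffixWeight (Pi.single b 1) x - suffixWeight (Pi.single b 1) y with hd
  have hsum (e : ZMod m → ℤ) : suffixWeight e x - suffixWeight e y = ∑ b, d b * e b := by
    rw [suffixWeight_eq_sum_single e x, suffixWeight_eq_sum_single e y, ← Finset.sum_sub_distrib]
    exact Finset.sum_congr rfl fun b _ => (sub_mul _ _ _).symm
  suffices d = 0 by simpa [this, sub_eq_zero] using hsum g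
  cases j with
  | zero =>
    funext b
    simp only [hd, ← sum_binom_pair, Pi.zero_apply, sub_eq_zero]
    exact Finset.sum_congr rfl fun c _ => congrArg Nat.cast (h [b, c] (by simp))
  | succ j =>
    refine eq_zero_of_binomForm_shift_invariant (j := j) ?_ fun b b' v hv => ?_
    · simpa [suffixWeight_one, hxy.length_eq] using (hsum 1).symm
    · have hw := binom_sigma_iterate_sub_of_perm j hxy hv b b'
      rw [h _ (by simp [hv]), sub_self, hsum, eq_comm, mul_eq_zero_iff_left
        (pow_ne_zero _ (Nat.cast_ne_zero.2 (NeZero.ne m)))] at hw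
      simpa [binomForm, mul_sub, sub_eq_zero] using hw

end BinomForm

section Letters

variable {A : Type*}

theorem length_factorAt (w : ℕ → A) (i n : ℕ) : (factorAt w i n).length = n := by
  simp [factorAt]

theorem getElem?_factorAt (w : ℕ → A) {i n s : ℕ} (hs : s < n) :
    (factorAt w i n)[s]? = some (w (i + s)) := by
  simp [factorAt, hs]

theorem mem_factorAt {w : ℕ → A} {i n s : ℕ} (hi : i ≤ s) (hs : s < i + n) :
    w s ∈ factorAt w i n :=
  List.mem_map.2 ⟨s - i, List.mem_range.2 (by omega), by rw [Nat.add_sub_cancel' hi]⟩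

theorem sum_map_factorAt {M : Type*} [AddCommMonoid M] (h : A → M) (w : ℕ → A) (i n : ℕ) :
    ((factorAt w i n).map h).sum = ∑ k ∈ Finset.range n, h (w (i + k)) := by
  rw [factorAt, List.map_map]; rfl

theorem factorAt_add (w : ℕ → A) (i n l : ℕ) :
    factorAt w i (n + l) = factorAt w i n ++ factorAt w (i + n) l := by
  simp [factorAt, List.range_add, add_assoc]

theorem factorAt_one (w : ℕ → A) (i : ℕ) : factorAt w i 1 = [w i] := by
  simp [factorAt]

variable {m : ℕ}

theorem getElem?_sigma (u : List (ZMod m)) (q : ℕ) {r : ℕ} (hr : r < m) :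
    (sigma m u)[m * q + r]? = u[q]?.map fun a => a + (r : ZMod m) := by
  induction u generalizing q with
  | nil => simp [sigma]
  | cons a u ih =>
    have hlength : (sigmaLetter m a).length = m := by simp [sigmaLetter_eq_map_range]
    rw [sigma, List.flatMap_cons, ← sigma]
    cases q with
    | zero =>
      rw [List.getElem?_append_left (by omega)]
      simp [sigmaLetter_eq_map_range, hr]
    | succ q =>
      rw [List.getElem?_append_right (by rw [hlength, mul_add_one]; omega), hlength,
        show m * (q + 1) + r - m = m * q + r by rw [mul_add_one]; omega, ih]
      simp

theorem thueMorse_mul_add (hm : 2 ≤ m) (q : ℕ) {r : ℕ} (hr : r < m) :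
    thueMorse m (m * q + r) = thueMorse m q + r := by
  have hq : q < m ^ q := Nat.lt_pow_self hm
  have hqr : m * q + r < m ^ (q + 1) := by rw [pow_succ]; nlinarith
  have h := getElem?_sigma ((sigma m)^[q] [0]) q hr
  rw [← Function.iterate_succ_apply' (sigma m), sigma_iterate_eq hm, sigma_iterate_eq hm,
    getElem?_factorAt _ hq, getElem?_factorAt _ hqr] at h
  simpa using h

theorem thueMorse_eq_div_add (hm : 2 ≤ m) (v : ℕ) : thueMorse m v = thueMorse m (v / m) + v := by
  conv_lhs => rw [← Nat.div_add_mod v m]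
  rw [thueMorse_mul_add hm _ (Nat.mod_lt _ (by omega)), ZMod.natCast_mod]

theorem thueMorse_mul (hm : 2 ≤ m) (q : ℕ) : thueMorse m (m * q) = thueMorse m q := by
  simpa using thueMorse_mul_add hm q (r := 0) (by omega)

theorem thueMorse_mul_add_pred (hm : 2 ≤ m) (q : ℕ) :
    thueMorse m (m * q + (m - 1)) = thueMorse m q - 1 := by
  rw [thueMorse_mul_add hm q (by omega), Nat.cast_sub (by omega)]
  simp [sub_eq_add_neg]

theorem thueMorse_of_lt (hm : 2 ≤ m) {v : ℕ} (hv : v < m) : thueMorse m v = v := by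
  rw [thueMorse_eq_div_add hm, Nat.div_eq_of_lt hv]
  simp [thueMorse]

theorem thueMorse_add_one_of_dvd (hm : 2 ≤ m) {v : ℕ} (hv : m ∣ v + 1) :
    thueMorse m v + 1 = thueMorse m (v / m) := by
  have hcast : (v : ZMod m) + 1 = 0 := mod_cast (ZMod.natCast_eq_zero_iff _ _).2 hv
  rw [thueMorse_eq_div_add hm v, add_assoc, hcast, add_zero]

theorem thueMorse_succ (hm : 2 ≤ m) {v : ℕ} (hv : ¬ m ∣ v + 1) :
    thueMorse m (v + 1) = thueMorse m v + 1 := by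
  rw [thueMorse_eq_div_add hm (v + 1), thueMorse_eq_div_add hm v, Nat.succ_div_of_not_dvd hv]
  push_cast
  ring

theorem dvd_of_thueMorse_succ_eq (hm : 2 ≤ m) {v : ℕ}
    (h : thueMorse m (v + 1) = thueMorse m v) : m ∣ v + 1 := by
  by_contra hv
  have : Fact (1 < m) := ⟨hm⟩
  rw [thueMorse_succ hm hv] at h
  exact one_ne_zero (add_eq_left.1 h)

theorem thueMorse_not_cube (hm : 2 ≤ m) {v : ℕ} {a : ZMod m} (h₀ : thueMorse m v = a)
    (h₁ : thueMorse m (v + 1) = a) (h₂ : thueMorse m (v + 2) = a) : False := by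
  have hdvd₁ := dvd_of_thueMorse_succ_eq hm (h₁.trans h₀.symm)
  have hdvd₂ := dvd_of_thueMorse_succ_eq hm (h₂.trans h₁.symm)
  have := Nat.le_of_dvd one_pos ((Nat.dvd_add_right hdvd₁).1 hdvd₂)
  omega

theorem exists_thueMorse_adjacent (hm : 2 ≤ m) (a b : ZMod m) :
    ∃ q, thueMorse m q = a ∧ thueMorse m (q + 1) = b := by
  have : NeZero m := ⟨by omega⟩
  -- The last letter of `σ_m(x)` is `x - 1`, so each passage to the image lowers the left letter.
  have hlower : ∀ s : ℕ, ∃ q, thueMorse m q = b - 1 - s ∧ thueMorse m (q + 1) = b := by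
    intro s
    induction s with
    | zero =>
      refine ⟨m * (b - 1).val, ?_, ?_⟩
      · rw [thueMorse_mul hm, thueMorse_of_lt hm (ZMod.val_lt _)]; simp
      · rw [thueMorse_mul_add hm _ hm, thueMorse_of_lt hm (ZMod.val_lt _)]; simp
    | succ s ih =>
      obtain ⟨q, hleft, hright⟩ := ih
      refine ⟨m * q + (m - 1), ?_, ?_⟩
      · rw [thueMorse_mul_add_pred hm, hleft]; push_cast; ring
      · rw [show m * q + (m - 1) + 1 = m * (q + 1) by rw [mul_add_one]; omega, thueMorse_mul hm,
          hright]
  obtain ⟨q, hleft, hright⟩ := hlower (b - 1 - a).val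
  exact ⟨q, by rw [hleft]; simp, hright⟩

theorem exists_thueMorse_pair (hm : 2 ≤ m) {d : ℕ} (hd : 0 < d) (a b : ZMod m) :
    ∃ q, thueMorse m q = a ∧ thueMorse m (q + d) = b := by
  induction d using Nat.strong_induction_on generalizing a b with
  | _ d ih =>
    rcases lt_or_ge d m with hdm | hdm
    · obtain ⟨q, hleft, hright⟩ := exists_thueMorse_adjacent hm (a + 1) (b - (d - 1 : ℕ))
      refine ⟨m * q + (m - 1), by rw [thueMorse_mul_add_pred hm, hleft]; ring, ?_⟩
      rw [show m * q + (m - 1) + d = m * (q + 1) + (d - 1) by rw [mul_add_one]; omega,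
        thueMorse_mul_add hm _ (by omega), hright, sub_add_cancel]
    · obtain ⟨q, hleft, hright⟩ := ih (d / m) (Nat.div_lt_self hd hm)
        (Nat.div_pos hdm (by omega)) a (b - (d % m : ℕ))
      refine ⟨m * q, by rw [thueMorse_mul hm, hleft], ?_⟩
      rw [show m * q + d = m * (q + d / m) + d % m by rw [mul_add, add_assoc, Nat.div_add_mod],
        thueMorse_mul_add hm _ (Nat.mod_lt _ (by omega)), hright, sub_add_cancel]

theorem sigma_factorAt (hm : 2 ≤ m) (q n : ℕ) :
    sigma m (factorAt (thueMorse m) q n) = factorAt (thueMorse m) (m * q) (m * n) := by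
  induction n with
  | zero => simp [factorAt, sigma]
  | succ n ih =>
    have hlast : sigmaLetter m (thueMorse m (q + n)) =
        factorAt (thueMorse m) (m * (q + n)) m := by
      rw [sigmaLetter_eq_map_range]
      exact List.map_congr_left fun r hr => (thueMorse_mul_add hm _ (List.mem_range.1 hr)).symm
    rw [factorAt_add, sigma_append, ih, mul_add_one, factorAt_add, factorAt_one, sigma_singleton,
      hlast, mul_add]

theorem sigma_iterate_factorAt (hm : 2 ≤ m) (j q n : ℕ) :
    (sigma m)^[j] (factorAt (thueMorse m) q n) =
      factorAt (thueMorse m) (m ^ j * q) (m ^ j * n) := by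
  induction j with
  | zero => simp
  | succ j ih =>
    rw [Function.iterate_succ_apply', ih, sigma_factorAt hm, ← mul_assoc, ← mul_assoc,
      ← pow_succ']

end Letters

section Alignment

variable {m : ℕ}

/-- Cutting the infinite word `t_m` into blocks of length `B`, the factor of length `n` at position
`p` meets the blocks numbered `p / B, …, (p + n) / B`. This word lists the letters of `t_m` indexed
by those blocks, the last one excluded. For `B = m ^ j` the block number `q` is `σ_m^j` of the
letter `q`. -/
def blockWord (m B n p : ℕ) : List (ZMod m) :=
  factorAt (thueMorse m) (p / B) ((p + n) / B - p / B)

/-- The factors of length `n` of `t_m` at positions `p` and `p'` are cut in the same way into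
blocks of length `B`: they start at the same place inside a block, the blocks which they meet only
partially agree, and the blocks in between are the same up to order. -/
structure Aligned (m B n p p' : ℕ) : Prop where
  modEq : p ≡ p' [MOD B]
  left_eq : ¬ B ∣ p → thueMorse m (p / B) = thueMorse m (p' / B)
  right_eq : ¬ B ∣ p + n → thueMorse m ((p + n) / B) = thueMorse m ((p' + n) / B)
  perm : (blockWord m B n p).Perm (blockWord m B n p')

theorem thueMorse_fwdDiff (hm : 2 ≤ m) (h : ZMod m → ℤ) (v : ℕ) :
    h (thueMorse m v + 1) - h (thueMorse m v) =
      (h (thueMorse m (v + 1)) - h (thueMorse m ((v + 1) / m))) -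
        (h (thueMorse m v) - h (thueMorse m (v / m))) := by
  by_cases hv : m ∣ v + 1
  · rw [thueMorse_add_one_of_dvd hm hv, thueMorse_eq_div_add hm (v + 1),
      (ZMod.natCast_eq_zero_iff _ _).2 hv, add_zero]
    ring
  · rw [← thueMorse_succ hm hv, Nat.succ_div_of_not_dvd hv]
    ring

/-- The sum of `h (a + 1) - h a` over the letters `a` of the factor of length `n` at position `p`,
in telescoped form. -/
def endTerm (m n p : ℕ) (h : ZMod m → ℤ) : ℤ :=
  h (thueMorse m (p + n)) - h (thueMorse m ((p + n) / m)) - h (thueMorse m p) +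
    h (thueMorse m (p / m))

/-- The part of the `suffixWeight` of `h (a + 1) - h a` that depends on how the factor of length
`n` at position `p` is cut into blocks of length `m`. -/
def blockTerm (m n p : ℕ) (h : ZMod m → ℤ) : ℤ :=
  m * ((blockWord m m n p).map h).sum + ((p + n) % m : ℕ) * h (thueMorse m ((p + n) / m)) -
    (p % m : ℕ) * h (thueMorse m (p / m)) +
    n * (h (thueMorse m (p + n)) - h (thueMorse m ((p + n) / m)))

theorem sum_fwdDiff_factorAt (hm : 2 ≤ m) (n p : ℕ) (h : ZMod m → ℤ) :
    ((factorAt (thueMorse m) p n).map fun a => h (a + 1) - h a).sum = endTerm m n p h := by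
  have htelescope := Finset.sum_range_sub (fun s =>
    h (thueMorse m (p + s)) - h (thueMorse m ((p + s) / m))) n
  simp only [← add_assoc, add_zero] at htelescope
  rw [sum_map_factorAt fun a => h (a + 1) - h a,
    Finset.sum_congr rfl fun s _ => thueMorse_fwdDiff hm h (p + s), htelescope, endTerm]
  ring

theorem sum_range_div {M : Type*} [CommSemiring M] (hm : 0 < m) (g : ℕ → M) (v : ℕ) :
    ∑ k ∈ Finset.range v, g (k / m) =
      m * ∑ q ∈ Finset.range (v / m), g q + (v % m : ℕ) * g (v / m) := by
  have hblock (q r : ℕ) (hr : r ≤ m) :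
      ∑ k ∈ Finset.range r, g ((m * q + k) / m) = r * g q := by
    rw [Finset.sum_congr rfl fun k hk => by
      rw [Nat.mul_add_div hm, Nat.div_eq_of_lt ((Finset.mem_range.1 hk).trans_le hr), add_zero]]
    simp
  have hblocks (q : ℕ) :
      ∑ k ∈ Finset.range (m * q), g (k / m) = m * ∑ s ∈ Finset.range q, g s := by
    induction q with
    | zero => simp
    | succ q ih =>
      rw [mul_add_one, Finset.sum_range_add, ih, hblock _ _ le_rfl, Finset.sum_range_succ, mul_add]
  conv_lhs => rw [← Nat.div_add_mod v m]
  rw [Finset.sum_range_add, hblocks, hblock _ _ (Nat.mod_lt _ hm).le]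

theorem suffixWeight_fwdDiff_factorAt (hm : 2 ≤ m) (n p : ℕ) (h : ZMod m → ℤ) :
    suffixWeight (fun a => h (a + 1) - h a) (factorAt (thueMorse m) p n) =
      ((factorAt (thueMorse m) p n).map h).sum - blockTerm m n p h + n * endTerm m n p h := by
  have hblocks : ∑ k ∈ Finset.range n, h (thueMorse m ((p + k) / m)) =
      m * ((blockWord m m n p).map h).sum + ((p + n) % m : ℕ) * h (thueMorse m ((p + n) / m)) -
        (p % m : ℕ) * h (thueMorse m (p / m)) := by
    have hupper := sum_range_div (by omega : 0 < m) (fun k => h (thueMorse m k)) (p + n)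
    have hlower := sum_range_div (by omega : 0 < m) (fun k => h (thueMorse m k)) p
    have hle : p / m ≤ (p + n) / m := Nat.div_le_div_right (Nat.le_add_right p n)
    rw [Finset.sum_range_add, ← Nat.add_sub_cancel' hle, Finset.sum_range_add,
      Nat.add_sub_cancel' hle, ← sum_map_factorAt, ← blockWord] at hupper
    linear_combination hupper - hlower
  have hinner (k : ℕ) : ∑ s ∈ Finset.range k,
      (h (thueMorse m (p + s) + 1) - h (thueMorse m (p + s))) = endTerm m k p h := by
    rw [← sum_fwdDiff_factorAt hm, sum_map_factorAt fun a => h (a + 1) - h a]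
  have hweight := suffixWeight_map_range (fun a => h (a + 1) - h a) (fun s => thueMorse m (p + s)) n
  rw [← factorAt, Finset.sum_congr rfl fun k _ => hinner k] at hweight
  simp only [endTerm, Finset.sum_add_distrib, Finset.sum_sub_distrib, Finset.sum_const,
    Finset.card_range, nsmul_eq_mul, hblocks, ← sum_map_factorAt] at hweight
  rw [hweight, endTerm, blockTerm]
  ring

theorem cast_blockTerm (n p : ℕ) (h : ZMod m → ℤ) :
    (blockTerm m n p h : ZMod m) =
      p * (h (thueMorse m ((p + n) / m)) - h (thueMorse m (p / m))) +
        n * h (thueMorse m (p + n)) := by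
  simp only [blockTerm]
  push_cast
  rw [ZMod.natCast_self]
  ring

theorem thueMorse_add_eq_div_add (hm : 2 ≤ m) (p n : ℕ) :
    thueMorse m (p + n) = thueMorse m ((p + n) / m) + (p + n) := by
  rw [thueMorse_eq_div_add hm, Nat.cast_add]

theorem endTerm_single (hm : 2 ≤ m) (n p : ℕ) (z : ZMod m) :
    endTerm m n p (Pi.single z 1) =
      (if thueMorse m ((p + n) / m) + (p + n) = z then 1 else 0) -
        (if thueMorse m ((p + n) / m) = z then 1 else 0) -
        (if thueMorse m (p / m) + p = z then 1 else 0) +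
        (if thueMorse m (p / m) = z then 1 else 0) := by
  simp only [endTerm, thueMorse_add_eq_div_add hm, thueMorse_eq_div_add hm p, Pi.single_apply]

theorem cast_blockTerm_single (hm : 2 ≤ m) (n p : ℕ) (z : ZMod m) :
    (blockTerm m n p (Pi.single z 1) : ZMod m) =
      p * ((if thueMorse m ((p + n) / m) = z then 1 else 0) -
        (if thueMorse m (p / m) = z then 1 else 0)) +
        n * (if thueMorse m ((p + n) / m) + (p + n) = z then 1 else 0) := by
  simp only [cast_blockTerm, thueMorse_add_eq_div_add hm, Pi.single_apply, Int.cast_ite,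
    Int.cast_one, Int.cast_zero]

/-- The factors at `p` and `p'` cannot be distinguished by the `suffixWeight`s of the functions
`h (a + 1) - h a`. -/
structure TermsAgree (m n p p' : ℕ) : Prop where
  endTerm_eq : endTerm m n p = endTerm m n p'
  blockTerm_eq : blockTerm m n p = blockTerm m n p'

theorem TermsAgree.symm {n p p' : ℕ} (h : TermsAgree m n p p') : TermsAgree m n p' p :=
  ⟨h.endTerm_eq.symm, h.blockTerm_eq.symm⟩

theorem termsAgree_of_suffixWeight_eq (hm : 2 ≤ m) {n p p' : ℕ}
    (hperm : (factorAt (thueMorse m) p n).Perm (factorAt (thueMorse m) p' n))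
    (hweight : ∀ g : ZMod m → ℤ, suffixWeight g (factorAt (thueMorse m) p n) =
      suffixWeight g (factorAt (thueMorse m) p' n)) : TermsAgree m n p p' := by
  have hend (h : ZMod m → ℤ) : endTerm m n p h = endTerm m n p' h := by
    rw [← sum_fwdDiff_factorAt hm, ← sum_fwdDiff_factorAt hm, (hperm.map _).sum_eq]
  refine ⟨funext hend, funext fun h => ?_⟩
  have := hweight fun a => h (a + 1) - h a
  rw [suffixWeight_fwdDiff_factorAt hm, suffixWeight_fwdDiff_factorAt hm, hend,
    (hperm.map h).sum_eq] at this
  linarith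

/-- The letter `b₀` indexes the blocks of length `m` which the factor of length `n` at position `p`
meets only partially. Such a letter exists unless the factor is cut inside two blocks that are
indexed by different letters. -/
structure IsAnchor (m n p : ℕ) (b₀ : ZMod m) : Prop where
  left_eq : (p : ZMod m) ≠ 0 → thueMorse m (p / m) = b₀
  right_eq : (p : ZMod m) + n ≠ 0 → thueMorse m ((p + n) / m) = b₀

theorem exists_isAnchor {n p : ℕ} (h : (p : ZMod m) ≠ 0 → (p : ZMod m) + n ≠ 0 →
    thueMorse m ((p + n) / m) = thueMorse m (p / m)) : ∃ b₀, IsAnchor m n p b₀ := by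
  by_cases hp : (p : ZMod m) = 0
  · exact ⟨_, fun hp' => (hp' hp).elim, fun _ => rfl⟩
  · exact ⟨_, fun _ => rfl, h hp⟩

theorem IsAnchor.endTerm_eq (hm : 2 ≤ m) {n p : ℕ} {b₀ : ZMod m} (hb₀ : IsAnchor m n p b₀)
    (h : ZMod m → ℤ) : endTerm m n p h = h (b₀ + p + n) - h (b₀ + p) := by
  rw [endTerm, thueMorse_add_eq_div_add hm, thueMorse_eq_div_add hm p]
  by_cases hp : (p : ZMod m) = 0 <;> by_cases hpn : (p : ZMod m) + n = 0
  · simp_all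
  · simp_all [hb₀.right_eq hpn]
  · rw [hpn, add_assoc, hpn, hb₀.left_eq hp]; ring_nf
  · rw [hb₀.left_eq hp, hb₀.right_eq hpn]; ring_nf

theorem div_add_sub_div_self (B p n : ℕ) : p / B + ((p + n) / B - p / B) = (p + n) / B :=
  Nat.add_sub_cancel' (Nat.div_le_div_right (Nat.le_add_right p n))

theorem length_blockWord (m B n p : ℕ) : (blockWord m B n p).length = (p + n) / B - p / B :=
  length_factorAt _ _ _

theorem mul_length_blockWord_add_mod (m B n p : ℕ) :
    B * (blockWord m B n p).length + (p + n) % B = n + p % B := by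
  have hp := Nat.div_add_mod p B
  have hpn := Nat.div_add_mod (p + n) B
  rw [← div_add_sub_div_self, mul_add, ← length_blockWord m] at hpn
  omega

theorem natCast_mod_eq_zero {v : ℕ} (hv : (v : ZMod m) = 0) : v % m = 0 :=
  Nat.mod_eq_zero_of_dvd ((ZMod.natCast_eq_zero_iff _ _).1 hv)

theorem mod_mul_thueMorse_div_eq {v : ℕ} {b : ZMod m}
    (h : (v : ZMod m) ≠ 0 → thueMorse m (v / m) = b) (g : ZMod m → ℤ) :
    ((v % m : ℕ) : ℤ) * g (thueMorse m (v / m)) = (v % m : ℕ) * g b := by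
  by_cases hv : (v : ZMod m) = 0
  · simp [natCast_mod_eq_zero hv]
  · rw [h hv]

theorem IsAnchor.blockTerm_eq (hm : 2 ≤ m) {n p : ℕ} {b₀ : ZMod m} (hb₀ : IsAnchor m n p b₀)
    (h : ZMod m → ℤ) :
    blockTerm m n p h =
      m * (((blockWord m m n p).map h).sum - (blockWord m m n p).length * h b₀) +
        n * h (b₀ + p + n) := by
  have hlength : (m : ℤ) * (blockWord m m n p).length + ((p + n) % m : ℕ) = n + (p % m : ℕ) :=
    mod_cast mul_length_blockWord_add_mod m m n p
  have hright : h (thueMorse m (p + n)) - h (thueMorse m ((p + n) / m)) =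
      h (b₀ + p + n) - h b₀ := by
    rw [thueMorse_add_eq_div_add hm, add_assoc b₀]
    by_cases hpn : (p : ZMod m) + n = 0
    · simp [hpn]
    · rw [hb₀.right_eq hpn]
  rw [blockTerm, hright, mod_mul_thueMorse_div_eq hb₀.left_eq,
    mod_mul_thueMorse_div_eq (mod_cast hb₀.right_eq)]
  linear_combination h b₀ * hlength

theorem sum_map_single {A : Type*} [DecidableEq A] (x : List A) (a : A) :
    (x.map (Pi.single a 1 : A → ℤ)).sum = x.count a := by
  induction x with
  | nil => simp
  | cons b x ih =>
    rw [List.map_cons, List.sum_cons, ih, List.count_cons, Pi.single_apply]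
    split_ifs <;> simp_all [add_comm]

theorem IsAnchor.blockWord_ne_replicate (hm : 2 ≤ m) {n p : ℕ} {b₀ : ZMod m}
    (hb₀ : IsAnchor m n p b₀) (hp : (p : ZMod m) ≠ 0) (hn : 2 * m ≤ n) (a : ZMod m) :
    (blockWord m m n p).count a ≠ (blockWord m m n p).length := by
  intro hcount
  have hconst {q : ℕ} (hpq : p / m ≤ q) (hq : q < (p + n) / m) : thueMorse m q = a :=
    (List.count_eq_length.1 hcount _ (mem_factorAt hpq (by omega))).symm
  have hle : p / m + 2 ≤ (p + n) / m := by
    rw [← Nat.add_mul_div_right p 2 (by omega : 0 < m)]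
    exact Nat.div_le_div_right (by omega)
  have hfirst : thueMorse m (p / m) = a := hconst le_rfl (by omega)
  refine thueMorse_not_cube hm hfirst (hconst (by omega) (by omega)) ?_
  rcases hle.lt_or_eq with hlt | heq
  · exact hconst (by omega) hlt
  · -- Three blocks do not fit into `n` letters, so the last block is cut and carries the anchor.
    rw [heq, ← hfirst, hb₀.left_eq hp]
    refine hb₀.right_eq fun hpn => ?_
    have hlength := mul_length_blockWord_add_mod m m n p
    have hmod : p % m ≠ 0 := fun h =>
      hp ((ZMod.natCast_eq_zero_iff _ _).2 (Nat.dvd_of_mod_eq_zero h))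
    rw [natCast_mod_eq_zero (mod_cast hpn), blockWord, length_factorAt, ← heq,
      Nat.add_sub_cancel_left] at hlength
    omega

theorem mul_length_blockWord_of_natCast_eq_zero {n : ℕ} (hn : (n : ZMod m) = 0) (p : ℕ) :
    m * (blockWord m m n p).length = n := by
  have := mul_length_blockWord_add_mod m m n p
  rwa [Nat.add_mod, natCast_mod_eq_zero hn, add_zero, Nat.mod_mod, Nat.add_right_cancel_iff] at this

theorem length_blockWord_eq_of_natCast_eq_zero {n : ℕ} (hm : 0 < m) (hn : (n : ZMod m) = 0)
    (p p' : ℕ) : (blockWord m m n p).length = (blockWord m m n p').length :=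
  Nat.eq_of_mul_eq_mul_left hm ((mul_length_blockWord_of_natCast_eq_zero hn p).trans
    (mul_length_blockWord_of_natCast_eq_zero hn p').symm)

section TermsAgree

variable {n p p' : ℕ} (hm : 2 ≤ m) (hterms : TermsAgree m n p p')
include hm hterms

theorem TermsAgree.right_eq_of_left_ne_right (hp : (p : ZMod m) ≠ 0) (hpn : (p : ZMod m) + n ≠ 0)
    (hne : thueMorse m ((p + n) / m) ≠ thueMorse m (p / m)) :
    thueMorse m ((p' + n) / m) = thueMorse m ((p + n) / m) := by
  have hend := congrFun hterms.endTerm_eq (Pi.single (thueMorse m ((p + n) / m)) 1)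
  have hblock := congrArg (Int.cast : ℤ → ZMod m)
    (congrFun hterms.blockTerm_eq (Pi.single (thueMorse m ((p + n) / m)) 1))
  rw [endTerm_single hm, endTerm_single hm] at hend
  rw [cast_blockTerm_single hm, cast_blockTerm_single hm] at hblock
  generalize thueMorse m ((p + n) / m) = b at *
  generalize thueMorse m ((p' + n) / m) = b' at *
  generalize thueMorse m (p / m) = c at *
  generalize thueMorse m (p' / m) = c' at *
  -- At the letter `b` the coefficient of `endTerm` is negative and that of `blockTerm` is `p`.
  simp only [add_eq_left, hpn, hne.symm, if_true, if_false, mul_one, mul_zero, sub_zero,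
    add_zero] at hblock hend
  by_contra hbb'
  obtain ⟨he, hc'b⟩ : b' + (p' + n) ≠ b ∧ c' ≠ b := by
    constructor <;> intro h <;> simp only [hbb', h, if_true, if_false] at hend <;>
      split_ifs at hend <;> omega
  simp [hbb', he, hc'b, hp] at hblock

theorem TermsAgree.natCast_eq_of_left_ne_right (hp : (p : ZMod m) ≠ 0)
    (hpn : (p : ZMod m) + n ≠ 0) (hne : thueMorse m ((p + n) / m) ≠ thueMorse m (p / m)) :
    (p : ZMod m) = p' := by
  have hend := congrFun hterms.endTerm_eq (Pi.single (thueMorse m ((p + n) / m)) 1)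
  have hblock := congrArg (Int.cast : ℤ → ZMod m)
    (congrFun hterms.blockTerm_eq (Pi.single (thueMorse m ((p + n) / m)) 1))
  rw [endTerm_single hm, endTerm_single hm] at hend
  rw [cast_blockTerm_single hm, cast_blockTerm_single hm] at hblock
  rw [hterms.right_eq_of_left_ne_right hm hp hpn hne] at hend hblock
  generalize thueMorse m ((p + n) / m) = b at *
  generalize thueMorse m (p / m) = c at *
  generalize thueMorse m (p' / m) = c' at *
  simp only [add_eq_left, hpn, hne.symm, if_true, if_false, mul_one, mul_zero, sub_zero,
    add_zero] at hblock hend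
  have hp'n : (p' : ZMod m) + n ≠ 0 := by
    intro hp'n
    have hc'b : c' ≠ b := by
      intro h
      simp only [hp'n, h, if_true] at hend
      split_ifs at hend <;> omega
    simp [hp'n, hc'b, hp] at hblock
  have hc'b : c' ≠ b := by
    intro h
    simp [h, hp'n, hp] at hblock
  simpa [hp'n, hc'b] using hblock

theorem TermsAgree.left_eq_of_left_ne_right (hp : (p : ZMod m) ≠ 0) (hpn : (p : ZMod m) + n ≠ 0)
    (hne : thueMorse m ((p + n) / m) ≠ thueMorse m (p / m)) :
    thueMorse m (p / m) = thueMorse m (p' / m) := by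
  have hend := congrFun hterms.endTerm_eq (Pi.single (thueMorse m (p / m)) 1)
  rw [endTerm_single hm, endTerm_single hm, hterms.right_eq_of_left_ne_right hm hp hpn hne,
    ← hterms.natCast_eq_of_left_ne_right hm hp hpn hne] at hend
  by_contra hcc'
  simp only [add_eq_left, hp, Ne.symm hcc', if_true, if_false] at hend
  split_ifs at hend <;> omega

variable {b₀ b₀' : ZMod m} (hb₀ : IsAnchor m n p b₀) (hb₀' : IsAnchor m n p' b₀')
include hb₀ hb₀'

theorem TermsAgree.count_blockWord_eq (a : ZMod m) :
    (m * ((blockWord m m n p).count a - (blockWord m m n p).length * (if a = b₀ then 1 else 0)) +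
        n * (if a = b₀ + p + n then 1 else 0) : ℤ) =
      m * ((blockWord m m n p').count a -
        (blockWord m m n p').length * (if a = b₀' then 1 else 0)) +
        n * (if a = b₀' + p' + n then 1 else 0) := by
  have h := congrFun hterms.blockTerm_eq (Pi.single a 1)
  rw [hb₀.blockTerm_eq hm, hb₀'.blockTerm_eq hm, sum_map_single, sum_map_single] at h
  simpa only [Pi.single_apply, eq_comm] using h

theorem TermsAgree.natCast_length_eq_zero_of_anchor_add_ne (hne : b₀ + p ≠ b₀' + p') :
    (n : ZMod m) = 0 := by
  by_contra hν
  have h := congrFun hterms.endTerm_eq (Pi.single (b₀ + p) 1)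
  rw [hb₀.endTerm_eq hm, hb₀'.endTerm_eq hm] at h
  simp only [Pi.single_apply, add_eq_left, hν, hne.symm, if_true, if_false] at h
  split_ifs at h <;> omega

theorem TermsAgree.count_blockWord_add_length_eq (hν : (n : ZMod m) = 0) (a : ZMod m) :
    ((blockWord m m n p).count a - (blockWord m m n p).length * (if a = b₀ then 1 else 0) +
        (blockWord m m n p).length * (if a = b₀ + p then 1 else 0) : ℤ) =
      (blockWord m m n p').count a - (blockWord m m n p).length * (if a = b₀' then 1 else 0) +
        (blockWord m m n p).length * (if a = b₀' + p' then 1 else 0) := by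
  have h := hterms.count_blockWord_eq hm hb₀ hb₀' a
  have hlength := mul_length_blockWord_of_natCast_eq_zero hν p
  rw [length_blockWord_eq_of_natCast_eq_zero (by omega) hν p' p, hν, add_zero, add_zero,
    ← hlength, Nat.cast_mul, mul_assoc, mul_assoc, ← mul_add, ← mul_add, hlength] at h
  exact mul_left_cancel₀ (by positivity) h

variable (hn : 2 * m ≤ n)
include hn

theorem TermsAgree.natCast_eq_zero_of_anchor_ne (hne : b₀ ≠ b₀') (heq : b₀ + p = b₀' + p') :
    (p : ZMod m) = 0 := by
  by_contra hp
  have h := hterms.count_blockWord_eq hm hb₀ hb₀' b₀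
  rw [heq, add_left_inj, mul_right_inj' (by positivity)] at h
  simp only [hne, if_true, if_false] at h
  have := (blockWord m m n p).count_le_length (a := b₀)
  exact hb₀.blockWord_ne_replicate hm hp hn b₀ (by omega)

theorem TermsAgree.natCast_eq_zero_of_anchor_add_ne (hne : b₀ + p ≠ b₀' + p') :
    (p : ZMod m) = 0 := by
  by_contra hp
  have hν := hterms.natCast_length_eq_zero_of_anchor_add_ne hm hb₀ hb₀' hne
  have hcount := hterms.count_blockWord_add_length_eq hm hb₀ hb₀' hν
  have hYX : (blockWord m m n p').length = (blockWord m m n p).length :=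
    length_blockWord_eq_of_natCast_eq_zero (by omega) hν p' p
  set X := blockWord m m n p
  set Y := blockWord m m n p'
  have hXpos : 0 < X.length :=
    Nat.pos_of_mul_pos_left (a := m) (by rw [mul_length_blockWord_of_natCast_eq_zero hν]; omega)
  have hYconst : Y.count (b₀ + p) = Y.length := by
    have h := hcount (b₀ + p)
    simp only [add_eq_left, hp, hne, if_true, if_false] at h
    have := Y.count_le_length (a := b₀ + p)
    split_ifs at h <;> omega
  have hp' : (p' : ZMod m) = 0 := by
    by_contra hp'
    exact hb₀'.blockWord_ne_replicate hm hp' hn _ hYconst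
  have hXconst : X.count b₀ = X.length := by
    have h := hcount b₀
    simp only [hp', add_zero, left_eq_add, hp, if_true, if_false] at h
    have := X.count_le_length (a := b₀)
    omega
  exact hb₀.blockWord_ne_replicate hm hp hn _ hXconst

theorem TermsAgree.eq_of_isAnchor :
    (p : ZMod m) = p' ∧ ((p : ZMod m) ≠ 0 → thueMorse m (p / m) = thueMorse m (p' / m)) := by
  by_cases heq : b₀ + (p : ZMod m) = b₀' + p'
  · by_cases hbb' : b₀ = b₀'
    · subst hbb'
      have hp := add_left_cancel heq
      exact ⟨hp, fun hp₀ => (hb₀.left_eq hp₀).trans (hb₀'.left_eq (hp ▸ hp₀)).symm⟩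
    · have hp := hterms.natCast_eq_zero_of_anchor_ne hm hb₀ hb₀' hn hbb' heq
      have hp' := hterms.symm.natCast_eq_zero_of_anchor_ne hm hb₀' hb₀ hn (Ne.symm hbb') heq.symm
      exact ⟨hp.trans hp'.symm, fun hp₀ => (hp₀ hp).elim⟩
  · have hp := hterms.natCast_eq_zero_of_anchor_add_ne hm hb₀ hb₀' hn heq
    have hp' := hterms.symm.natCast_eq_zero_of_anchor_add_ne hm hb₀' hb₀ hn (Ne.symm heq)
    exact ⟨hp.trans hp'.symm, fun hp₀ => (hp₀ hp).elim⟩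

omit hb₀ hb₀'

theorem TermsAgree.left_eq :
    (p : ZMod m) = p' ∧ ((p : ZMod m) ≠ 0 → thueMorse m (p / m) = thueMorse m (p' / m)) := by
  by_cases h : (p : ZMod m) ≠ 0 → (p : ZMod m) + n ≠ 0 →
    thueMorse m ((p + n) / m) = thueMorse m (p / m)
  · by_cases h' : (p' : ZMod m) ≠ 0 → (p' : ZMod m) + n ≠ 0 →
      thueMorse m ((p' + n) / m) = thueMorse m (p' / m)
    · obtain ⟨b₀, hb₀⟩ := exists_isAnchor h
      obtain ⟨b₀', hb₀'⟩ := exists_isAnchor h'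
      exact hterms.eq_of_isAnchor hm hb₀ hb₀' hn
    · push Not at h'
      obtain ⟨hp', hpn', hne⟩ := h'
      exact ⟨(hterms.symm.natCast_eq_of_left_ne_right hm hp' hpn' hne).symm,
        fun _ => (hterms.symm.left_eq_of_left_ne_right hm hp' hpn' hne).symm⟩
  · push Not at h
    obtain ⟨hp, hpn, hne⟩ := h
    exact ⟨hterms.natCast_eq_of_left_ne_right hm hp hpn hne,
      fun _ => hterms.left_eq_of_left_ne_right hm hp hpn hne⟩

theorem TermsAgree.sub_thueMorse_div_eq (h : ZMod m → ℤ) :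
    h (thueMorse m (p + n)) - h (thueMorse m ((p + n) / m)) =
      h (thueMorse m (p' + n)) - h (thueMorse m ((p' + n) / m)) := by
  obtain ⟨hpp', hc⟩ := hterms.left_eq hm hn
  have hstart : h (thueMorse m (p / m)) - h (thueMorse m p) =
      h (thueMorse m (p' / m)) - h (thueMorse m p') := by
    rw [thueMorse_eq_div_add hm p, thueMorse_eq_div_add hm p', ← hpp']
    by_cases hp : (p : ZMod m) = 0
    · simp [hp]
    · rw [hc hp]
  have hend := congrFun hterms.endTerm_eq h
  simp only [endTerm] at hend
  linear_combination hend - hstart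

theorem TermsAgree.right_eq (hpn : (p : ZMod m) + n ≠ 0) :
    thueMorse m ((p + n) / m) = thueMorse m ((p' + n) / m) := by
  by_contra hne
  have h := hterms.sub_thueMorse_div_eq hm hn (Pi.single (thueMorse m ((p + n) / m)) 1)
  simp only [thueMorse_add_eq_div_add hm, ← (hterms.left_eq hm hn).1, Pi.single_apply,
    add_eq_left, hpn, Ne.symm hne, if_true, if_false] at h
  split_ifs at h <;> omega

theorem TermsAgree.perm_blockWord : (blockWord m m n p).Perm (blockWord m m n p') := by
  obtain ⟨hpp', hc⟩ := hterms.left_eq hm hn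
  have hmod : p % m = p' % m := (ZMod.natCast_eq_natCast_iff _ _ _).1 hpp'
  have hmod_add : (p + n) % m = (p' + n) % m := Nat.ModEq.add_right n hmod
  refine List.perm_iff_count.2 fun a => ?_
  have h := congrFun hterms.blockTerm_eq (Pi.single a 1)
  have hb : ((p + n : ℕ) : ZMod m) ≠ 0 →
      thueMorse m ((p + n) / m) = thueMorse m ((p' + n) / m) :=
    mod_cast hterms.right_eq hm hn
  rw [blockTerm, blockTerm, hterms.sub_thueMorse_div_eq hm hn, mod_mul_thueMorse_div_eq hc,
    mod_mul_thueMorse_div_eq hb, hmod, hmod_add, sum_map_single, sum_map_single, add_left_inj,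
    sub_left_inj, add_left_inj, mul_right_inj' (by positivity)] at h
  exact_mod_cast h

theorem TermsAgree.aligned : Aligned m m n p p' where
  modEq := (ZMod.natCast_eq_natCast_iff _ _ _).1 (hterms.left_eq hm hn).1
  left_eq hp := (hterms.left_eq hm hn).2 (mt (ZMod.natCast_eq_zero_iff _ _).1 hp)
  right_eq hpn := hterms.right_eq hm hn (mod_cast mt (ZMod.natCast_eq_zero_iff _ _).1 hpn)
  perm := hterms.perm_blockWord hm hn

end TermsAgree

end Alignment

section Characterization

variable {m : ℕ}

theorem blockWord_mul (B n p : ℕ) :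
    blockWord m (B * m) n p = blockWord m m ((p + n) / B - p / B) (p / B) := by
  simp only [blockWord, div_add_sub_div_self, Nat.div_div_eq_div_mul]

theorem modEq_mul {B v w : ℕ} (h : v ≡ w [MOD B]) (hdiv : v / B ≡ w / B [MOD m]) :
    v ≡ w [MOD B * m] := by
  rw [Nat.ModEq, Nat.mod_mul, Nat.mod_mul, h, hdiv]

theorem thueMorse_div_mul_eq (hm : 2 ≤ m) {B v w : ℕ}
    (heq : ¬ B ∣ v → thueMorse m (v / B) = thueMorse m (w / B))
    (hmod : v / B ≡ w / B [MOD m])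
    (hdiv : ¬ m ∣ v / B → thueMorse m (v / B / m) = thueMorse m (w / B / m))
    (hv : ¬ B * m ∣ v) : thueMorse m (v / (B * m)) = thueMorse m (w / (B * m)) := by
  rw [← Nat.div_div_eq_div_mul, ← Nat.div_div_eq_div_mul]
  by_cases hvm : m ∣ v / B
  · have hwm : m ∣ w / B := (hmod.dvd_iff dvd_rfl).1 hvm
    rw [← thueMorse_mul hm (v / B / m), ← thueMorse_mul hm (w / B / m),
      Nat.mul_div_cancel' hvm, Nat.mul_div_cancel' hwm]
    exact heq fun hB => hv (Nat.mul_dvd_of_dvd_div hB hvm)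
  · exact hdiv hvm

theorem Aligned.mul (hm : 2 ≤ m) {B n p p' : ℕ} (h : Aligned m B n p p')
    (h' : Aligned m m ((p + n) / B - p / B) (p / B) (p' / B)) : Aligned m (B * m) n p p' := by
  have hlength : (p + n) / B - p / B = (p' + n) / B - p' / B := by
    simpa only [length_blockWord] using h.perm.length_eq
  have hend := div_add_sub_div_self B p n
  have hend' : p' / B + ((p + n) / B - p / B) = (p' + n) / B := by
    rw [hlength, div_add_sub_div_self]
  have hmod := h'.modEq.add_right ((p + n) / B - p / B)
  have hright := h'.right_eq
  rw [hend, hend'] at hmod hright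
  refine ⟨modEq_mul h.modEq h'.modEq, thueMorse_div_mul_eq hm h.left_eq h'.modEq h'.left_eq,
    thueMorse_div_mul_eq hm h.right_eq hmod hright, ?_⟩
  rw [blockWord_mul, blockWord_mul, ← hlength]
  exact h'.perm

theorem factorAt_eq_of_thueMorse_eq (hm : 2 ≤ m) (j : ℕ) {q q' r : ℕ} (hr : r ≤ m ^ j)
    (h : thueMorse m q = thueMorse m q') :
    factorAt (thueMorse m) (m ^ j * q) r = factorAt (thueMorse m) (m ^ j * q') r := by
  have htake (q : ℕ) : factorAt (thueMorse m) (m ^ j * q) r =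
      ((sigma m)^[j] [thueMorse m q]).take r := by
    rw [← factorAt_one, sigma_iterate_factorAt hm, mul_one, ← Nat.add_sub_cancel' hr, factorAt_add,
      List.take_left' (length_factorAt _ _ _)]
  rw [htake, htake, h]

theorem factorAt_block_mod_eq (hm : 2 ≤ m) (j : ℕ) {v w : ℕ} (hmod : v ≡ w [MOD m ^ j])
    (h : ¬ m ^ j ∣ v → thueMorse m (v / m ^ j) = thueMorse m (w / m ^ j)) :
    factorAt (thueMorse m) (m ^ j * (v / m ^ j)) (v % m ^ j) =
      factorAt (thueMorse m) (m ^ j * (w / m ^ j)) (w % m ^ j) := by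
  rw [← hmod]
  by_cases hv : m ^ j ∣ v
  · simp [Nat.mod_eq_zero_of_dvd hv, factorAt]
  · exact factorAt_eq_of_thueMorse_eq hm j (Nat.mod_lt _ (by positivity)).le (h hv)

theorem factorAt_append_factorAt (hm : 2 ≤ m) (j n p : ℕ) :
    factorAt (thueMorse m) (m ^ j * (p / m ^ j)) (p % m ^ j) ++ factorAt (thueMorse m) p n =
      (sigma m)^[j] (blockWord m (m ^ j) n p) ++
        factorAt (thueMorse m) (m ^ j * ((p + n) / m ^ j)) ((p + n) % m ^ j) := by
  have hstart := factorAt_add (thueMorse m) (m ^ j * (p / m ^ j)) (p % m ^ j) n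
  have hend := factorAt_add (thueMorse m) (m ^ j * (p / m ^ j))
    (m ^ j * ((p + n) / m ^ j - p / m ^ j)) ((p + n) % m ^ j)
  rw [Nat.div_add_mod] at hstart
  rw [← mul_add, div_add_sub_div_self] at hend
  rw [blockWord, sigma_iterate_factorAt hm, ← hstart, ← hend]
  congr 1
  have hp := Nat.div_add_mod p (m ^ j)
  have hpn := Nat.div_add_mod (p + n) (m ^ j)
  rw [← div_add_sub_div_self, mul_add] at hpn
  omega

theorem Aligned.binomEquiv_iff (hm : 2 ≤ m) {j k n p p' : ℕ} (h : Aligned m (m ^ j) n p p') :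
    BinomEquiv k (factorAt (thueMorse m) p n) (factorAt (thueMorse m) p' n) ↔
      BinomEquiv k ((sigma m)^[j] (blockWord m (m ^ j) n p))
        ((sigma m)^[j] (blockWord m (m ^ j) n p')) := by
  have hcut := factorAt_append_factorAt hm j n p
  have hcut' := factorAt_append_factorAt hm j n p'
  rw [← factorAt_block_mod_eq hm j h.modEq h.left_eq,
    ← factorAt_block_mod_eq hm j (h.modEq.add_right n) h.right_eq] at hcut'
  constructor <;> intro hequiv
  · refine BinomEquiv.cancel_right (hcut ▸ hcut' ▸ (BinomEquiv.refl k _).append hequiv)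
  · refine BinomEquiv.cancel_left (hcut.symm ▸ hcut'.symm ▸ hequiv.append (BinomEquiv.refl k _))

theorem Aligned.binomEquiv (hm : 2 ≤ m) {j n p p' : ℕ} (h : Aligned m (m ^ j) n p p') :
    BinomEquiv (j + 1) (factorAt (thueMorse m) p n) (factorAt (thueMorse m) p' n) := by
  have : NeZero m := ⟨by omega⟩
  exact (h.binomEquiv_iff hm).2 (BinomEquiv.sigma_iterate_of_perm j h.perm)

theorem aligned_one_iff_perm {n p p' : ℕ} :
    Aligned m 1 n p p' ↔
      (factorAt (thueMorse m) p n).Perm (factorAt (thueMorse m) p' n) := by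
  have hblock (p : ℕ) : blockWord m 1 n p = factorAt (thueMorse m) p n := by simp [blockWord]
  rw [← hblock, ← hblock]
  exact ⟨Aligned.perm, fun h => ⟨Nat.modEq_one, by simp, by simp, h⟩⟩

theorem aligned_of_binomEquiv (hm : 2 ≤ m) {j n p p' : ℕ} (hn : m ^ (j + 1) ≤ n)
    (h : BinomEquiv (j + 1) (factorAt (thueMorse m) p n) (factorAt (thueMorse m) p' n)) :
    Aligned m (m ^ j) n p p' := by
  have : NeZero m := ⟨by omega⟩
  induction j with
  | zero => exact aligned_one_iff_perm.2 (binomEquiv_one_iff_perm.1 h)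
  | succ j ih =>
    have haligned : Aligned m (m ^ j) n p p' :=
      ih ((Nat.pow_le_pow_right (by omega) (by omega)).trans hn) (h.mono (by omega))
    have hlength : (p + n) / m ^ j - p / m ^ j = (p' + n) / m ^ j - p' / m ^ j := by
      simpa only [length_blockWord] using haligned.perm.length_eq
    have hblocks : m * m ≤ (p + n) / m ^ j - p / m ^ j := by
      have hsplit : p / m ^ j + n / m ^ j ≤ (p + n) / m ^ j := Nat.div_add_div_le_add_div
      have : m * m ≤ n / m ^ j := by
        rw [Nat.le_div_iff_mul_le (by positivity)]
        exact le_of_eq_of_le (by ring) hn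
      omega
    have hweight := suffixWeight_eq_of_binomEquiv haligned.perm ((haligned.binomEquiv_iff hm).1 h)
    have hperm := haligned.perm
    simp only [blockWord, ← hlength] at hperm hweight
    rw [pow_succ]
    exact haligned.mul hm ((termsAgree_of_suffixWeight_eq hm hperm hweight).aligned hm
      ((Nat.mul_le_mul_right m hm).trans hblocks))

theorem binomEquiv_factorAt_iff_aligned (hm : 2 ≤ m) {j n p p' : ℕ} (hn : m ^ (j + 1) ≤ n) :
    BinomEquiv (j + 1) (factorAt (thueMorse m) p n) (factorAt (thueMorse m) p' n) ↔
      Aligned m (m ^ j) n p p' :=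
  ⟨aligned_of_binomEquiv hm hn, Aligned.binomEquiv hm⟩

end Characterization

section Periodicity

variable {m : ℕ}

theorem card_quotient_eq_of_biTotal {X Y : Type*} (r : Setoid X) (s : Setoid Y)
    {T : X → Y → Prop} (hT : Relator.BiTotal T)
    (hrs : ∀ ⦃x x' y y'⦄, T x y → T x' y' → (r x x' ↔ s y y')) :
    Nat.card (Quotient r) = Nat.card (Quotient s) := by
  choose f hf using hT.1
  refine Nat.card_eq_of_bijective
    (Quotient.map f fun x x' hxx' => (hrs (hf x) (hf x')).1 hxx') ⟨?_, ?_⟩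
  · rintro ⟨x⟩ ⟨x'⟩ hxx'
    exact Quotient.sound ((hrs (hf x) (hf x')).2 (Quotient.exact hxx'))
  · rintro ⟨y⟩
    obtain ⟨x, hxy⟩ := hT.2 y
    exact ⟨Quotient.mk r x, Quotient.sound ((hrs (hf x) hxy).1 (r.refl x))⟩

theorem binomComplexity_eq_of_biTotal {A A' : Type*} [DecidableEq A] [DecidableEq A']
    {w : ℕ → A} {w' : ℕ → A'} {k n n' : ℕ} {T : ℕ → ℕ → Prop} (hT : Relator.BiTotal T)
    (hequiv : ∀ ⦃p p' q q'⦄, T p q → T p' q' →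
      (BinomEquiv k (factorAt w p n) (factorAt w p' n) ↔
        BinomEquiv k (factorAt w' q n') (factorAt w' q' n'))) :
    binomComplexity k w n = binomComplexity k w' n' := by
  refine card_quotient_eq_of_biTotal (factorSetoid k w n) (factorSetoid k w' n')
    (T := fun u v => ∃ p q, u.1 = factorAt w p n ∧ v.1 = factorAt w' q n' ∧ T p q) ⟨?_, ?_⟩ ?_
  · rintro ⟨_, p, rfl⟩
    obtain ⟨q, hpq⟩ := hT.1 p
    exact ⟨⟨_, q, rfl⟩, p, q, rfl, rfl, hpq⟩
  · rintro ⟨_, q, rfl⟩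
    obtain ⟨p, hpq⟩ := hT.2 q
    exact ⟨⟨_, p, rfl⟩, p, q, rfl, rfl, hpq⟩
  · rintro ⟨u, hu⟩ ⟨u', hu'⟩ ⟨v, hv⟩ ⟨v', hv'⟩ ⟨p, q, rfl, rfl, h⟩ ⟨p', q', rfl, rfl, h'⟩
    exact hequiv h h'

theorem binomComplexity_zero {A : Type*} [DecidableEq A] (w : ℕ → A) (n : ℕ) :
    binomComplexity 0 w n = 1 := by
  refine Nat.card_eq_one_iff_unique.2 ⟨⟨?_⟩, ⟨Quotient.mk _ ⟨_, 0, rfl⟩⟩⟩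
  rintro ⟨u⟩ ⟨v⟩
  exact Quotient.sound (binomEquiv_zero _ _)

/-- The factor of length `n` of `t_m` at position `p` and the one of length `n'` at position `q`
start at the same place inside a block of length `M`, and the blocks in which they start have the
same letter, as do the blocks in which they end. -/
structure SameEnds (m M n n' p q : ℕ) : Prop where
  modEq : p ≡ q [MOD M]
  left_eq : thueMorse m (p / M) = thueMorse m (q / M)
  right_eq : thueMorse m ((p + n) / M) = thueMorse m ((q + n') / M)

theorem SameEnds.symm {M n n' p q : ℕ} (h : SameEnds m M n n' p q) : SameEnds m M n' n q p :=
  ⟨h.modEq.symm, h.left_eq.symm, h.right_eq.symm⟩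

theorem exists_sameEnds (hm : 2 ≤ m) {M n' : ℕ} (hM : 0 < M) (hn' : M ≤ n') (n p : ℕ) :
    ∃ q, SameEnds m M n n' p q := by
  obtain ⟨s, hleft, hright⟩ := exists_thueMorse_pair hm (d := (p % M + n') / M)
    (Nat.div_pos (by omega) hM) (thueMorse m (p / M)) (thueMorse m ((p + n) / M))
  refine ⟨M * s + p % M, ?_, ?_, ?_⟩
  · rw [Nat.ModEq, Nat.mul_add_mod, Nat.mod_mod]
  · rw [Nat.mul_add_div hM, Nat.div_eq_of_lt (Nat.mod_lt _ hM), add_zero, hleft]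
  · rw [add_assoc, Nat.mul_add_div hM, hright]

theorem biTotal_sameEnds (hm : 2 ≤ m) {M n n' : ℕ} (hM : 0 < M) (hn : M ≤ n) (hn' : M ≤ n') :
    Relator.BiTotal (SameEnds m M n n') :=
  ⟨exists_sameEnds hm hM hn' n,
    fun q => (exists_sameEnds hm hM hn n' q).imp fun _ h => h.symm⟩

theorem div_modEq_of_modEq_mul {B v w : ℕ} (h : v ≡ w [MOD B * m]) : v / B ≡ w / B [MOD m] := by
  rw [Nat.ModEq, ← Nat.mod_mul_right_div_self, ← Nat.mod_mul_right_div_self, h]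

theorem thueMorse_div_eq (hm : 2 ≤ m) {B v w : ℕ} (hmod : v ≡ w [MOD B * m])
    (h : thueMorse m (v / (B * m)) = thueMorse m (w / (B * m))) :
    thueMorse m (v / B) = thueMorse m (w / B) := by
  rw [thueMorse_eq_div_add hm, thueMorse_eq_div_add hm (w / B), Nat.div_div_eq_div_mul,
    Nat.div_div_eq_div_mul, h, (ZMod.natCast_eq_natCast_iff _ _ _).2 (div_modEq_of_modEq_mul hmod)]

theorem count_blockWord_add_count (hm : 2 ≤ m) (B n p : ℕ) (a : ZMod m) :
    (factorAt (thueMorse m) (m * (p / (B * m))) (p / B % m)).count a +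
        (blockWord m B n p).count a =
      (blockWord m (B * m) n p).length +
        (factorAt (thueMorse m) (m * ((p + n) / (B * m))) ((p + n) / B % m)).count a := by
  have : NeZero m := ⟨by omega⟩
  have h := factorAt_append_factorAt hm 1 ((p + n) / B - p / B) (p / B)
  simp only [pow_one, div_add_sub_div_self, Function.iterate_one, ← blockWord_mul,
    Nat.div_div_eq_div_mul] at h
  have hcount := congrArg (List.count a) h
  rwa [List.count_append, List.count_append, count_sigma] at hcount

theorem factorAt_div_mod_eq (hm : 2 ≤ m) {B v w : ℕ} (hmod : v ≡ w [MOD B * m])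
    (h : thueMorse m (v / (B * m)) = thueMorse m (w / (B * m))) :
    factorAt (thueMorse m) (m * (v / (B * m))) (v / B % m) =
      factorAt (thueMorse m) (m * (w / (B * m))) (w / B % m) := by
  have hblock := factorAt_block_mod_eq hm 1 (v := v / B) (w := w / B)
  simp only [pow_one, Nat.div_div_eq_div_mul] at hblock
  exact hblock (div_modEq_of_modEq_mul hmod) fun _ => h

namespace SameEnds

variable {B M n n' p p' q q' : ℕ}

theorem add_modEq (h : SameEnds m M n (n + M) p q) : p + n ≡ q + (n + M) [MOD M] :=
  h.modEq.add (by simp [Nat.ModEq])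

theorem length_blockWord_add_period (hM : 0 < M) (h : SameEnds m M n (n + M) p q) :
    (blockWord m M (n + M) q).length = (blockWord m M n p).length + 1 := by
  have hp := mul_length_blockWord_add_mod m M n p
  have hq := mul_length_blockWord_add_mod m M (n + M) q
  rw [← h.modEq, ← h.add_modEq] at hq
  refine Nat.eq_of_mul_eq_mul_left hM ?_
  rw [mul_add_one]
  omega

theorem count_blockWord_add_period (hm : 2 ≤ m) (hB : 0 < B)
    (h : SameEnds m (B * m) n (n + B * m) p q) (a : ZMod m) :
    (blockWord m B (n + B * m) q).count a = (blockWord m B n p).count a + 1 := by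
  have hp := count_blockWord_add_count hm B n p a
  have hq := count_blockWord_add_count hm B (n + B * m) q a
  rw [← factorAt_div_mod_eq hm h.modEq h.left_eq, ← factorAt_div_mod_eq hm h.add_modEq h.right_eq,
    h.length_blockWord_add_period (by positivity)] at hq
  omega

theorem aligned_iff (hm : 2 ≤ m) (hB : 0 < B) (h : SameEnds m (B * m) n (n + B * m) p q)
    (h' : SameEnds m (B * m) n (n + B * m) p' q') :
    Aligned m B n p p' ↔ Aligned m B (n + B * m) q q' := by
  have hmod : p ≡ q [MOD B] := h.modEq.of_mul_right m
  have hmod' : p' ≡ q' [MOD B] := h'.modEq.of_mul_right m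
  have hmodEq_iff : p ≡ p' [MOD B] ↔ q ≡ q' [MOD B] := by rw [Nat.ModEq, hmod, hmod', Nat.ModEq]
  have hdvd_left : B ∣ p ↔ B ∣ q := hmod.dvd_iff dvd_rfl
  have hdvd_right : B ∣ p + n ↔ B ∣ q + (n + B * m) :=
    (h.add_modEq.of_mul_right m).dvd_iff dvd_rfl
  have hperm_iff : (blockWord m B n p).Perm (blockWord m B n p') ↔
      (blockWord m B (n + B * m) q).Perm (blockWord m B (n + B * m) q') := by
    simp only [List.perm_iff_count, h.count_blockWord_add_period hm hB,
      h'.count_blockWord_add_period hm hB, Nat.add_right_cancel_iff]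
  have hleft := thueMorse_div_eq hm h.modEq h.left_eq
  have hleft' := thueMorse_div_eq hm h'.modEq h'.left_eq
  have hright := thueMorse_div_eq hm h.add_modEq h.right_eq
  have hright' := thueMorse_div_eq hm h'.add_modEq h'.right_eq
  constructor <;> rintro ⟨hmodEq, hleft_eq, hright_eq, hperm⟩
  · rw [hdvd_left, hleft, hleft'] at hleft_eq
    rw [hdvd_right, hright, hright'] at hright_eq
    exact ⟨hmodEq_iff.1 hmodEq, hleft_eq, hright_eq, hperm_iff.1 hperm⟩
  · rw [← hdvd_left, ← hleft, ← hleft'] at hleft_eq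
    rw [← hdvd_right, ← hright, ← hright'] at hright_eq
    exact ⟨hmodEq_iff.2 hmodEq, hleft_eq, hright_eq, hperm_iff.2 hperm⟩

end SameEnds

end Periodicity

end GenThueMorse

open GenThueMorse in
theorem mainTheorem3_general (m k : ℕ) (hm : 2 ≤ m) :
    ∀ n : ℕ, m ^ k ≤ n →
      binomComplexity k (thueMorse m) (n + m ^ k) = binomComplexity k (thueMorse m) n := by
  intro n hn
  cases k with
  | zero => rw [binomComplexity_zero, binomComplexity_zero]
  | succ j =>
    have hn' : m ^ (j + 1) ≤ n + m ^ (j + 1) := Nat.le_add_left _ _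
    refine (binomComplexity_eq_of_biTotal
      (biTotal_sameEnds hm (by positivity) hn hn') fun p p' q q' h h' => ?_).symm
    rw [binomEquiv_factorAt_iff_aligned hm hn, binomEquiv_factorAt_iff_aligned hm hn']
    exact h.aligned_iff hm (by positivity) h'

theorem mainTheorem3 (m k : ℕ) (hm : 2 ≤ m) (hk : 2 ≤ k) :
    ∀ n : ℕ, m ^ k ≤ n →
      GenThueMorse.binomComplexity k (GenThueMorse.thueMorse m) (n + m ^ k) =
        GenThueMorse.binomComplexity k (GenThueMorse.thueMorse m) n :=
  mainTheorem3_general m k hm
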